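/- Let $Q$ be a (positive Borel) measure on $\mathbb R$. For $\beta$ in the canonical parameter space $\Gamma=\{\beta\in\mathbb R: Z(\beta)=\int e^{\beta x}\,\mathrm dQ(x)<\infty\}$ let $P_\beta$ be the probability measure with $\mathrm dP_\beta/\mathrm dQ\,(x)=e^{\beta x}/Z(\beta)$. Let $M$ be the mean value range, i.e. the set of finite means of the measures $P_\beta$, $\beta\in\Gamma$. For $x\in M$ let $P^x$ be the element of the family with mean $x$. The family is extended by $P^x=\delta_x$ for $x=\inf M>-\infty$ if $Q(\{x\})>0$ and $Q((-\infty,x))=0$, and for $x=\sup M<\infty$ if $Q(\{x\})>0$ and $Q((x,\infty))=0$. Let $V(x)$ be the variance of $P^x$, and let $D$ denote information (Kullback–Leibler) divergence. The convex core of $Q$ is the intersection of all convex measurable sets whose complement is a $Q$-null set. Theorem. Suppose that the convex core of $Q$ is bounded below, and let $a=\inf M$ be the left end point of $M$. Suppose that for some $\varepsilon>0$, $\gamma\in\mathbb R$ and some function $g$ analytic at $a$ with $g(a)>0$, the restriction of $Q$ to $(a,a+\varepsilon)$ has density $(x-a)^{\gamma-1}g(x)$ with respect to Lebesgue measure (a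 point mass of $Q$ at $a$ is allowed). Let $\beta_0\in\Gamma$ be such that $P_{\beta_0}$ has finite mean, and consider the right-truncated exponential family $\{P_\beta:\beta\in\Gamma,\ \beta\le\beta_0\}$, with mean value range $M_0\subseteq M$. Then for every $m\ge 1$ and every sample $x^m=(x_1,\dots,x_m)$ of real numbers whose average $\bar x=\frac1m\sum_i x_i$ is the mean of an element of the (full) extended exponential family, the conditional Jeffreys integral of the right-truncated family is finite: $$J\mid x^m=\int_{M_0}\frac{\exp\bigl(-m\,D(P^{\bar x}\,\|\,P^{y})\bigr)}{V(y)^{1/2}}\,\mathrm dy<\infty .$$ -/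

import Mathlib

open MeasureTheory ProbabilityTheory InformationTheory
open scoped ENNReal

/-- The convex core of a measure on the real line: the intersection of all convex measurable sets
of full measure. -/
def convexCore (Q : Measure ℝ) : Set ℝ :=
  ⋂₀ {C : Set ℝ | Convex ℝ C ∧ MeasurableSet C ∧ Q Cᶜ = 0}

/-- The canonical parameter space of the exponential family based on `Q`: all real `β` for which
`Z(β) = ∫ exp (β * x) dQ(x)` is finite. -/
def canonicalSpace (Q : Measure ℝ) : Set ℝ :=
  integrableExpSet id Q

/-- The element `P_β` of the exponential family: the measure with density `exp (β * x) / Z(β)`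
with respect to `Q`. -/
noncomputable def expMember (Q : Measure ℝ) (β : ℝ) : Measure ℝ :=
  Q.tilted (fun x => β * x)

/-- `P_β` has finite mean, equal to `x`. -/
def HasMean (Q : Measure ℝ) (β x : ℝ) : Prop :=
  Integrable id (expMember Q β) ∧ ∫ y, y ∂(expMember Q β) = x

/-- The (finite) mean values of the elements `P_β` with `β` in the set `B` of parameters.
The mean value range of the full family is `meanRange Q (canonicalSpace Q)`. -/
def meanRange (Q : Measure ℝ) (B : Set ℝ) : Set ℝ :=
  {x | ∃ β ∈ B, HasMean Q β x}

/-- The mean value range of the extended exponential family: a finite end point `x` of the mean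
value range is added if `Q` has a point mass at `x` and no mass beyond `x`. -/
def extendedMeanRange (Q : Measure ℝ) : Set ℝ :=
  meanRange Q (canonicalSpace Q)
    ∪ {x | IsGLB (meanRange Q (canonicalSpace Q)) x ∧ Q {x} ≠ 0 ∧ Q (Set.Iio x) = 0}
    ∪ {x | IsLUB (meanRange Q (canonicalSpace Q)) x ∧ Q {x} ≠ 0 ∧ Q (Set.Ioi x) = 0}

open Classical in
/-- The element `P^x` of the extended exponential family with mean `x`, for `x` in
`extendedMeanRange Q`: the member `P_β` with mean `x` if there is one (it is unique), and
the point mass at `x` at an added end point. Values at other `x` are irrelevant. -/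
noncomputable def meanMember (Q : Measure ℝ) (x : ℝ) : Measure ℝ :=
  if h : ∃ β ∈ canonicalSpace Q, HasMean Q β x then expMember Q h.choose else Measure.dirac x

/-- The variance function, with values in `[0, ∞]`. -/
noncomputable def varianceFunction (Q : Measure ℝ) (x : ℝ) : ℝ≥0∞ :=
  evariance id (meanMember Q x)

/-- The average of a finite sequence. -/
noncomputable def sampleAverage {m : ℕ} (x : Fin m → ℝ) : ℝ :=
  (∑ i, x i) / m

/-- The conditional Jeffreys integral, given the sample `x`, of the family based on `Q` with
parameters restricted to `B`:
`∫ exp (-m D(P^x̄ ‖ P^y)) / V(y) ^ (1/2) dy` over the mean values `y` of the restricted family. -/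
noncomputable def conditionalJeffreys (Q : Measure ℝ) (B : Set ℝ) {m : ℕ} (x : Fin m → ℝ) :
    ℝ≥0∞ :=
  ∫⁻ y in meanRange Q B,
    EReal.exp (-((m : EReal) *
        ((klDiv (meanMember Q (sampleAverage x)) (meanMember Q y) : ℝ≥0∞) : EReal)))
      / (varianceFunction Q y) ^ (1 / 2 : ℝ)

/-- The parameters of the exponential family based on `Q`, truncated on the right at `β₀`. -/
def rightTruncation (Q : Measure ℝ) (β₀ : ℝ) : Set ℝ :=
  canonicalSpace Q ∩ Set.Iic β₀

open Filter Topology Set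

/-! In the canonical parameter the mean `y` satisfies `dy = V dβ`, so the integral is at most `∫
exp(-m D) √V dβ` over `β < β₀`, and only the two ends need an estimate.

Near `β₀` use `exp(-m D) ≤ 1` and `√V ≤ 1 + V`: the integral of `V` over a bounded parameter
interval is the length of the interval of means it sweeps out, finite because `P_{β₀}` has a mean
(`lintegral_Ico_sqrt_varMap_lt_top`).

Near `-∞` there are two cases. If `x̄ > a`, then `exp(-m D)` is at most a constant times the
likelihood `exp(β x̄) / Z(β)` (`exists_exp_klDiv_le`). Since `Q` charges every interval `(a, a +
δ)`, this decays exponentially and beats the possible growth of `V` (`exists_lintegral_Iio_lt_top`).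
Otherwise `x̄ = a`, which requires an atom at `a`. The divergence no longer helps, but the atom
keeps `Z(β) exp(-β a)` away from `0`, while a negative moment of order `p` of `Q` on `(a, ∞)` makes
`V = O((β₀ - β)^(-(2 + p)))`. So `√V` is integrable (`exists_sqrt_varMap_le_rpow`); `p = γ / 2`
works. -/

/-! ### Integrability in the exponential family -/

theorem mem_canonicalSpace_iff {Q : Measure ℝ} {β : ℝ} :
    β ∈ canonicalSpace Q ↔ Integrable (fun x => Real.exp (β * x)) Q := Iff.rfl

/-- A measure with an integrable exponential is finite on compact sets. -/
theorem isFiniteMeasureOnCompacts_of_mem_canonicalSpace {Q : Measure ℝ} {β : ℝ}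
    (h : β ∈ canonicalSpace Q) : IsFiniteMeasureOnCompacts Q := by
  refine ⟨fun {K} hK => ?_⟩
  have hc : Continuous fun x : ℝ => Real.exp (β * x) := by fun_prop
  rcases K.eq_empty_or_nonempty with rfl | hne
  · simp
  obtain ⟨x₀, -, hx₀⟩ := hK.exists_isMinOn hne hc.continuousOn
  -- `K` lies in a superlevel set of the exponential at a positive level, which has finite measure
  -- by Markov's inequality.
  refine (measure_mono fun x hx => ?_).trans_lt
    (Integrable.measure_norm_ge_lt_top (mem_canonicalSpace_iff.1 h) (Real.exp_pos (β * x₀)))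
  have : Real.exp (β * x₀) ≤ Real.exp (β * x) := hx₀ hx
  simpa using this

theorem sigmaFinite_of_mem_canonicalSpace {Q : Measure ℝ} {β : ℝ}
    (h : β ∈ canonicalSpace Q) : SigmaFinite Q := by
  have := isFiniteMeasureOnCompacts_of_mem_canonicalSpace h
  infer_instance

/-- If `Q` has no mass below `l`, exponential integrability passes to smaller parameters. -/
theorem integrable_exp_mul_of_le {Q : Measure ℝ} {l β β₀ : ℝ} (hl : Q (Iio l) = 0) (hβ : β ≤ β₀)
    {f : ℝ → ℝ} (hf : Integrable (fun x => Real.exp (β₀ * x) * f x) Q) :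
    Integrable (fun x => Real.exp (β * x) * f x) Q := by
  have hmeas : AEStronglyMeasurable (fun x : ℝ => Real.exp ((β - β₀) * x)) Q :=
    (by fun_prop : Continuous fun x : ℝ => Real.exp ((β - β₀) * x)).aestronglyMeasurable
  have hae : ∀ᵐ x ∂Q, l ≤ x := by
    rw [ae_iff]; simpa [Iio] using hl
  -- As `β - β₀ ≤ 0`, the factor `exp((β - β₀) x)` is largest at `l`.
  have := hf.bdd_mul (c := Real.exp ((β - β₀) * l)) hmeas (by
    filter_upwards [hae] with x hx
    rw [Real.norm_eq_abs, Real.abs_exp, Real.exp_le_exp]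
    nlinarith)
  refine this.congr (ae_of_all _ fun x => ?_)
  simp only
  rw [← mul_assoc, ← Real.exp_add]
  congr 2
  ring

theorem mem_canonicalSpace_of_le {Q : Measure ℝ} {l β β₀ : ℝ} (hl : Q (Iio l) = 0) (hβ : β ≤ β₀)
    (h : β₀ ∈ canonicalSpace Q) : β ∈ canonicalSpace Q := by
  rw [mem_canonicalSpace_iff] at *
  simpa using integrable_exp_mul_of_le (f := fun _ => 1) hl hβ (by simpa using h)

theorem integrable_expMember_iff {Q : Measure ℝ} {β : ℝ} (h : β ∈ canonicalSpace Q) {f : ℝ → ℝ} :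
    Integrable f (expMember Q β) ↔ Integrable (fun x => Real.exp (β * x) * f x) Q :=
  integrable_tilted_iff (mem_canonicalSpace_iff.1 h) f

theorem integrable_expMember_of_le {Q : Measure ℝ} {l β β₀ : ℝ} (hl : Q (Iio l) = 0)
    (hβ : β ≤ β₀) (h : β₀ ∈ canonicalSpace Q) {f : ℝ → ℝ} (hf : Integrable f (expMember Q β₀)) :
    Integrable f (expMember Q β) := by
  rw [integrable_expMember_iff (mem_canonicalSpace_of_le hl hβ h)]
  rw [integrable_expMember_iff h] at hf
  exact integrable_exp_mul_of_le hl hβ hf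

theorem mgf_id_pos {Q : Measure ℝ} {β : ℝ} (hQ : Q ≠ 0) (h : β ∈ canonicalSpace Q) :
    0 < ∫ x, Real.exp (β * x) ∂Q :=
  mgf_pos' (X := id) hQ h

theorem integral_expMember {Q : Measure ℝ} (β : ℝ) (f : ℝ → ℝ) :
    ∫ x, f x ∂(expMember Q β)
      = (∫ x, Real.exp (β * x) * f x ∂Q) / ∫ x, Real.exp (β * x) ∂Q := by
  rw [expMember, integral_tilted, ← integral_div]
  congr with x
  simp only [smul_eq_mul]
  ring

theorem isProbabilityMeasure_expMember {Q : Measure ℝ} {β : ℝ} (hQ : Q ≠ 0)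
    (h : β ∈ canonicalSpace Q) : IsProbabilityMeasure (expMember Q β) := by
  have : NeZero Q := ⟨hQ⟩
  exact isProbabilityMeasure_tilted (mem_canonicalSpace_iff.1 h)

/-! ### Mean and variance in the canonical parameter -/

/-- The mean of the member `P_β`. -/
noncomputable def meanMap (Q : Measure ℝ) (β : ℝ) : ℝ := ∫ y, y ∂(expMember Q β)

/-- The mean is strictly increasing in the canonical parameter. -/
theorem meanMap_lt_meanMap {Q : Measure ℝ} {β₁ β₂ : ℝ} (hQ : ∀ c, ¬ ∀ᵐ x ∂Q, x = c)
    (h₁ : β₁ ∈ canonicalSpace Q) (h₂ : β₂ ∈ canonicalSpace Q)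
    (i₁ : Integrable id (expMember Q β₁)) (i₂ : Integrable id (expMember Q β₂)) (h : β₁ < β₂) :
    meanMap Q β₁ < meanMap Q β₂ := by
  have hQ0 : Q ≠ 0 := by rintro rfl; exact hQ 0 (by simp)
  have hZ₁ := mgf_id_pos hQ0 h₁
  have hZ₂ := mgf_id_pos hQ0 h₂
  set c := meanMap Q β₁ with hc
  rw [integrable_expMember_iff h₁] at i₁
  rw [integrable_expMember_iff h₂] at i₂
  simp only [id] at i₁ i₂
  rw [mem_canonicalSpace_iff] at h₁ h₂
  have e₁ : ∫ x, Real.exp (β₁ * x) * (x - c) ∂Q = 0 := by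
    simp_rw [mul_sub]
    rw [integral_sub i₁ (h₁.mul_const c), integral_mul_const, hc, meanMap, integral_expMember]
    field_simp
    ring
  have j₁ : Integrable (fun x => Real.exp (β₁ * x) * (x - c)) Q := by
    simp_rw [mul_sub]; exact i₁.sub (h₁.mul_const c)
  have j₂ : Integrable (fun x => Real.exp (β₂ * x) * (x - c)) Q := by
    simp_rw [mul_sub]; exact i₂.sub (h₂.mul_const c)
  set k := Real.exp ((β₂ - β₁) * c) with hk
  -- The difference is `exp(β₁ x) (exp((β₂ - β₁) x) - exp((β₂ - β₁) c)) (x - c)`, whose last two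
  -- factors share their sign and vanish only at `c`. By `e₁` the subtracted term integrates to
  -- zero.
  have key : ∀ x, 0 ≤ Real.exp (β₂ * x) * (x - c) - k * (Real.exp (β₁ * x) * (x - c)) ∧
      (Real.exp (β₂ * x) * (x - c) - k * (Real.exp (β₁ * x) * (x - c)) = 0 → x = c) := by
    intro x
    have e : Real.exp (β₂ * x) * (x - c) - k * (Real.exp (β₁ * x) * (x - c))
        = Real.exp (β₁ * x) * ((Real.exp ((β₂ - β₁) * x) - k) * (x - c)) := by
      have : Real.exp (β₂ * x) = Real.exp (β₁ * x) * Real.exp ((β₂ - β₁) * x) := by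
        rw [← Real.exp_add]; congr 1; ring
      rw [this]; ring
    rw [e]
    have hp := Real.exp_pos (β₁ * x)
    rcases lt_trichotomy x c with hx | hx | hx
    · have : Real.exp ((β₂ - β₁) * x) < k := Real.exp_lt_exp.2 (by nlinarith)
      have h3 : 0 < (Real.exp ((β₂ - β₁) * x) - k) * (x - c) :=
        mul_pos_of_neg_of_neg (by linarith) (by linarith)
      exact ⟨(mul_pos hp h3).le, fun h0 => absurd h0 (mul_pos hp h3).ne'⟩
    · exact ⟨by simp [hx], fun _ => hx⟩
    · have : k < Real.exp ((β₂ - β₁) * x) := Real.exp_lt_exp.2 (by nlinarith)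
      have h3 : 0 < (Real.exp ((β₂ - β₁) * x) - k) * (x - c) :=
        mul_pos (by linarith) (by linarith)
      exact ⟨(mul_pos hp h3).le, fun h0 => absurd h0 (mul_pos hp h3).ne'⟩
  have e₂ : 0 < ∫ x, Real.exp (β₂ * x) * (x - c) ∂Q := by
    have hint := j₂.sub (j₁.const_mul k)
    have hnn : 0 ≤ ∫ x, (Real.exp (β₂ * x) * (x - c) - k * (Real.exp (β₁ * x) * (x - c))) ∂Q :=
      integral_nonneg fun x => (key x).1
    have heq : ∫ x, (Real.exp (β₂ * x) * (x - c) - k * (Real.exp (β₁ * x) * (x - c))) ∂Q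
        = ∫ x, Real.exp (β₂ * x) * (x - c) ∂Q := by
      rw [integral_sub j₂ (j₁.const_mul k), integral_const_mul, e₁]; simp
    rw [heq] at hnn
    refine lt_of_le_of_ne hnn fun h0 => hQ c ?_
    rw [← heq] at h0
    have := (integral_eq_zero_iff_of_nonneg (fun x => (key x).1) hint).1 h0.symm
    filter_upwards [this] with x hx using (key x).2 hx
  have e₃ : ∫ x, Real.exp (β₂ * x) * (x - c) ∂Q
      = (meanMap Q β₂ - c) * ∫ x, Real.exp (β₂ * x) ∂Q := by
    simp_rw [mul_sub]
    rw [integral_sub i₂ (h₂.mul_const c), integral_mul_const, meanMap, integral_expMember]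
    field_simp
  rw [e₃] at e₂
  have := pos_of_mul_pos_left e₂ hZ₂.le
  linarith

/-- The measure with mean `meanMap Q β` in the extended family is the member `P_β`. -/
theorem meanMember_meanMap {Q : Measure ℝ} {β : ℝ} (hQ : ∀ c, ¬ ∀ᵐ x ∂Q, x = c)
    (h : β ∈ canonicalSpace Q) (i : Integrable id (expMember Q β)) :
    meanMember Q (meanMap Q β) = expMember Q β := by
  have hex : ∃ β' ∈ canonicalSpace Q, HasMean Q β' (meanMap Q β) := ⟨β, h, i, rfl⟩
  rw [meanMember, dif_pos hex]
  obtain ⟨h₁, i₁, e₁⟩ := hex.choose_spec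
  congr 1
  rcases lt_trichotomy hex.choose β with hlt | heq | hlt
  · exact absurd e₁ (meanMap_lt_meanMap hQ h₁ h i₁ i hlt).ne
  · exact heq
  · exact absurd e₁ (meanMap_lt_meanMap hQ h h₁ i i₁ hlt).ne'

/-- The variance function of the family in terms of the canonical parameter. -/
noncomputable def varMap (Q : Measure ℝ) (β : ℝ) : ℝ := Var[id; expMember Q β]

theorem meanMap_eventuallyEq_deriv_cgf {Q : Measure ℝ} {β : ℝ}
    (h : β ∈ interior (canonicalSpace Q)) : meanMap Q =ᶠ[𝓝 β] deriv (cgf id Q) := by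
  filter_upwards [isOpen_interior.mem_nhds h] with t ht
  exact integral_tilted_mul_self (X := id) ht

/-- Mean and variance are the first two derivatives of the cumulant generating function. This is the
Jacobian `dy = V dβ` of the change of variables. -/
theorem hasDerivAt_meanMap {Q : Measure ℝ} {β : ℝ} (h : β ∈ interior (canonicalSpace Q)) :
    HasDerivAt (meanMap Q) (varMap Q β) β := by
  have e : varMap Q β = iteratedDeriv 2 (cgf id Q) β := variance_tilted_mul (X := id) h
  have hd : HasDerivAt (deriv (cgf id Q)) (deriv (deriv (cgf id Q)) β) β :=
    (analyticAt_cgf (X := id) h).deriv.differentiableAt.hasDerivAt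
  rw [e, iteratedDeriv_succ, iteratedDeriv_one]
  exact hd.congr_of_eventuallyEq (meanMap_eventuallyEq_deriv_cgf h)

theorem memLp_two_expMember {Q : Measure ℝ} {β : ℝ} (h : β ∈ interior (canonicalSpace Q)) :
    MemLp id 2 (expMember Q β) :=
  memLp_tilted_mul (X := id) h 2

theorem varianceFunction_meanMap {Q : Measure ℝ} {β : ℝ} (hQ : ∀ c, ¬ ∀ᵐ x ∂Q, x = c)
    (h : β ∈ interior (canonicalSpace Q)) :
    varianceFunction Q (meanMap Q β) = ENNReal.ofReal (varMap Q β) := by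
  have hQ0 : Q ≠ 0 := by rintro rfl; exact hQ 0 (by simp)
  have := isProbabilityMeasure_expMember hQ0 (interior_subset h)
  have hL := memLp_two_expMember h
  rw [varianceFunction, meanMember_meanMap hQ (interior_subset h)
    (hL.integrable (by norm_num)), varMap, ofReal_variance hL]

/-- The variance of `P_β` is at most the second moment about any point. -/
theorem varMap_le {Q : Measure ℝ} {β : ℝ} (hQ : Q ≠ 0) (h : β ∈ interior (canonicalSpace Q))
    (a : ℝ) :
    varMap Q β ≤ (∫ x, Real.exp (β * x) * (x - a) ^ 2 ∂Q) / ∫ x, Real.exp (β * x) ∂Q := by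
  have := isProbabilityMeasure_expMember hQ (interior_subset h)
  have hL := memLp_two_expMember h
  rw [← integral_expMember β fun x => (x - a) ^ 2, varMap,
    ← variance_sub_const hL.aestronglyMeasurable a]
  exact variance_le_expectation_sq (hL.aestronglyMeasurable.sub aestronglyMeasurable_const)

/-! ### Divergence and likelihood -/

/-- A lower bound of the divergence by the integrated log likelihood ratio, in exponential form. -/
theorem ereal_exp_neg_mul_klDiv_le {μ ν : Measure ℝ} [IsProbabilityMeasure μ]
    [IsProbabilityMeasure ν] {m : ℕ} (hm : 1 ≤ m) {L : ℝ}
    (hL : μ ≪ ν → Integrable (llr μ ν) μ → ∫ x, llr μ ν x ∂μ = L) :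
    EReal.exp (-((m : EReal) * ((klDiv μ ν : ℝ≥0∞) : EReal))) ≤ ENNReal.ofReal (Real.exp (-L)) := by
  rw [← EReal.exp_coe, EReal.exp_le_exp_iff, EReal.coe_neg, EReal.neg_le_neg_iff]
  have h1 : (L : EReal) ≤ ((klDiv μ ν : ℝ≥0∞) : EReal) := by
    -- Outside this case the divergence is infinite and every `L` is a lower bound.
    by_cases h : μ ≪ ν ∧ Integrable (llr μ ν) μ
    · rw [klDiv_of_ac_of_integrable h.1 h.2, hL h.1 h.2]
      simp only [probReal_univ, add_sub_cancel_right, EReal.coe_ennreal_ofReal]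
      exact EReal.coe_le_coe_iff.2 (le_max_left _ _)
    · have : klDiv μ ν = ∞ := klDiv_eq_top_iff.2 fun h1 h2 => h ⟨h1, h2⟩
      rw [this]; simp
  refine h1.trans ?_
  have h2 : (1 : EReal) ≤ (m : EReal) := by exact_mod_cast hm
  calc ((klDiv μ ν : ℝ≥0∞) : EReal) = 1 * ((klDiv μ ν : ℝ≥0∞) : EReal) := (one_mul _).symm
    _ ≤ _ := mul_le_mul_of_nonneg_right h2 (EReal.coe_ennreal_nonneg _)

theorem ereal_exp_neg_mul_klDiv_le_one (μ ν : Measure ℝ) (m : ℕ) :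
    EReal.exp (-((m : EReal) * ((klDiv μ ν : ℝ≥0∞) : EReal))) ≤ 1 := by
  rw [EReal.exp_le_one_iff, EReal.neg_le_zero]
  exact mul_nonneg (by exact_mod_cast Nat.zero_le m) (EReal.coe_ennreal_nonneg _)

/-- The log likelihood ratio of two members is affine in `x`, so its integral depends only on the
mean. -/
theorem integral_llr_expMember {Q : Measure ℝ} (hQ : Q ≠ 0) {β β' : ℝ}
    (h : β ∈ canonicalSpace Q) (h' : β' ∈ canonicalSpace Q)
    (i : Integrable id (expMember Q β)) :
    ∫ x, llr (expMember Q β) (expMember Q β') x ∂(expMember Q β)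
      = (β - β') * meanMap Q β - Real.log (∫ x, Real.exp (β * x) ∂Q)
        + Real.log (∫ x, Real.exp (β' * x) ∂Q) := by
  have := sigmaFinite_of_mem_canonicalSpace h
  have := isProbabilityMeasure_expMember hQ h
  have hac : expMember Q β ≪ Q := tilted_absolutelyContinuous _ _
  have e1 := llr_tilted_right hac (mem_canonicalSpace_iff.1 h')
  have e2 := hac.ae_le (log_rnDeriv_tilted_left_self (mem_canonicalSpace_iff.1 h))
  have e3 : llr (expMember Q β) (expMember Q β') =ᵐ[expMember Q β] fun x =>
      (β - β') * x + (Real.log (∫ x, Real.exp (β' * x) ∂Q)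
        - Real.log (∫ x, Real.exp (β * x) ∂Q)) := by
    filter_upwards [e1, e2] with x hx1 hx2
    rw [show llr (expMember Q β) (expMember Q β') x = _ from hx1,
      show llr (expMember Q β) Q x = _ from hx2]
    ring
  have i' : Integrable (fun x : ℝ => x) (expMember Q β) := i
  rw [integral_congr_ae e3, integral_add (i'.const_mul (β - β')) (integrable_const _),
    integral_const_mul, integral_const, meanMap]
  simp
  ring

/-- At `x` the density of the point mass relative to `P_β` is the reciprocal of `P_β {x}`. -/
theorem integral_llr_dirac {Q : Measure ℝ} (hQ : Q ≠ 0) {β x : ℝ}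
    (h : β ∈ canonicalSpace Q) (hx : Q {x} ≠ 0) :
    ∫ y, llr (Measure.dirac x) (expMember Q β) y ∂(Measure.dirac x)
      = -Real.log (Real.exp (β * x) / (∫ x, Real.exp (β * x) ∂Q) * Q.real {x}) := by
  have := isFiniteMeasureOnCompacts_of_mem_canonicalSpace h
  have := isProbabilityMeasure_expMember hQ h
  have hZ := mgf_id_pos hQ h
  have hp : 0 < Q.real {x} := ENNReal.toReal_pos hx isCompact_singleton.measure_lt_top.ne
  have e1 : (expMember Q β) {x}
      = ENNReal.ofReal (Real.exp (β * x) / (∫ x, Real.exp (β * x) ∂Q) * Q.real {x}) := by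
    rw [expMember, tilted_apply' _ _ (measurableSet_singleton x), lintegral_singleton,
      ENNReal.ofReal_mul (by positivity), ofReal_measureReal isCompact_singleton.measure_lt_top.ne]
  have hac : Measure.dirac x ≪ expMember Q β := by
    refine Measure.AbsolutelyContinuous.mk fun s hs h0 => ?_
    rw [Measure.dirac_apply' _ hs, indicator_of_notMem]
    intro hxs
    have := measure_mono_null (singleton_subset_iff.2 hxs) h0
    rw [e1, ENNReal.ofReal_eq_zero] at this
    exact absurd this (not_le.2 (by positivity))
  have e2 : (expMember Q β).withDensity ((Measure.dirac x).rnDeriv (expMember Q β)) {x}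
      = 1 := by
    rw [Measure.withDensity_rnDeriv_eq _ _ hac]; simp
  rw [withDensity_apply _ (measurableSet_singleton x), lintegral_singleton] at e2
  rw [integral_dirac, llr, ENNReal.eq_inv_of_mul_eq_one_left e2, e1, ENNReal.toReal_inv,
    ENNReal.toReal_ofReal (by positivity), Real.log_inv]

/-- For every mean `x` of the extended family, `exp (-m D(P^x ‖ P_β))` is at most a constant times
the likelihood `exp (β x) / Z(β)`. -/
theorem exists_exp_klDiv_le {Q : Measure ℝ} (hQ : Q ≠ 0) {x : ℝ} (hx : x ∈ extendedMeanRange Q)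
    {m : ℕ} (hm : 1 ≤ m) :
    ∃ C, 0 < C ∧ ∀ β ∈ canonicalSpace Q,
      EReal.exp (-((m : EReal) * ((klDiv (meanMember Q x) (expMember Q β) : ℝ≥0∞) : EReal)))
        ≤ ENNReal.ofReal (C * Real.exp (β * x) / ∫ x, Real.exp (β * x) ∂Q) := by
  by_cases hex : ∃ β ∈ canonicalSpace Q, HasMean Q β x
  · obtain ⟨h, i, e⟩ := hex.choose_spec
    rw [meanMember, dif_pos hex]
    set b := hex.choose
    have hZ := mgf_id_pos hQ h
    refine ⟨(∫ x, Real.exp (b * x) ∂Q) * Real.exp (-(b * x)), by positivity, fun β hβ => ?_⟩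
    have hZ' := mgf_id_pos hQ hβ
    have := isProbabilityMeasure_expMember hQ h
    have := isProbabilityMeasure_expMember hQ hβ
    refine (ereal_exp_neg_mul_klDiv_le hm fun _ _ => integral_llr_expMember hQ h hβ i).trans
      (le_of_eq ?_)
    congr 1
    rw [show meanMap Q b = x from e]
    calc _ = Real.exp (Real.log (∫ x, Real.exp (b * x) ∂Q) + -(b * x) + β * x
          - Real.log (∫ x, Real.exp (β * x) ∂Q)) := by congr 1; ring
      _ = _ := by rw [Real.exp_sub, Real.exp_add, Real.exp_add, Real.exp_log hZ, Real.exp_log hZ']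
  · have hx0 : Q {x} ≠ 0 := by
      rcases hx with (⟨β, hβ, h⟩ | h) | h
      · exact absurd ⟨β, hβ, h⟩ hex
      · exact h.2.1
      · exact h.2.1
    rw [meanMember, dif_neg hex]
    by_cases hΓ : ∃ β, β ∈ canonicalSpace Q
    swap
    · exact ⟨1, one_pos, fun β hβ => absurd ⟨β, hβ⟩ hΓ⟩
    obtain ⟨b, hb⟩ := hΓ
    have := isFiniteMeasureOnCompacts_of_mem_canonicalSpace hb
    have hp : 0 < Q.real {x} := ENNReal.toReal_pos hx0 isCompact_singleton.measure_lt_top.ne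
    refine ⟨Q.real {x}, hp, fun β hβ => ?_⟩
    have hZ' := mgf_id_pos hQ hβ
    have := isProbabilityMeasure_expMember hQ hβ
    refine (ereal_exp_neg_mul_klDiv_le hm fun _ _ => integral_llr_dirac hQ hβ hx0).trans
      (le_of_eq ?_)
    rw [neg_neg, Real.exp_log (by positivity)]
    congr 1
    ring

/-! ### The support lies to the right of `a` -/

/-- A measure with bounded below convex core that charges a bounded above set has no mass far to
the left. -/
theorem exists_measure_Iio_eq_zero {Q : Measure ℝ} (hcore : BddBelow (convexCore Q)) {a : ℝ}
    (ha : Q (Ioi a) ≠ 0) : ∃ l, Q (Iio l) = 0 := by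
  by_contra! hne
  obtain ⟨b, hb⟩ := hcore
  -- This point is below the bound `b`, yet has mass on both sides, so every convex set of full
  -- measure contains it.
  have hmem : min a b - 1 ∈ convexCore Q := by
    rintro C ⟨hC, -, h0⟩
    have hmeet : ∀ s : Set ℝ, Q s ≠ 0 → (s ∩ C).Nonempty := by
      intro s hs
      by_contra hemp
      exact hs (measure_mono_null (fun y hy hyC => hemp ⟨y, hy, hyC⟩) h0)
    obtain ⟨u, hu, huC⟩ := hmeet _ (hne (min a b - 1))
    obtain ⟨v, hv, hvC⟩ := hmeet _ ha
    have : a < v := hv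
    have : u < min a b - 1 := hu
    exact hC.ordConnected.out huC hvC ⟨by linarith, by linarith [min_le_left a b]⟩
  linarith [hb hmem, min_le_right a b]

/-- `Q` has no mass to the left of the mean value range. -/
theorem measure_Iio_eq_zero_of_isGLB {Q : Measure ℝ} (hQ : Q ≠ 0) {l β₀ a : ℝ}
    (hl : Q (Iio l) = 0) (hβ₀ : β₀ ∈ canonicalSpace Q) (hmean : Integrable id (expMember Q β₀))
    (ha : IsGLB (meanRange Q (canonicalSpace Q)) a) : Q (Iio a) = 0 := by
  suffices H : ∀ c < a, Q (Iio c) = 0 by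
    have : Iio a = ⋃ n : ℕ, Iio (a - 1 / (n + 1)) := by
      ext y
      simp only [mem_Iio, mem_iUnion]
      constructor
      · intro hy
        obtain ⟨n, hn⟩ := exists_nat_one_div_lt (sub_pos.2 hy)
        exact ⟨n, by linarith⟩
      · rintro ⟨n, hn⟩
        have : (0 : ℝ) < 1 / (n + 1) := by positivity
        linarith
    rw [this]
    refine measure_iUnion_null fun n => H _ ?_
    have : (0 : ℝ) < 1 / (n + 1) := by positivity
    linarith
  intro c hc
  -- As `β → -∞`, mass left of `c` would pull the mean below `a`. All members `P_{β₀ - n}` have mean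
  -- at least `a`, which gives `nonneg`.
  by_contra hne
  have i0 : Integrable (fun x => Real.exp (β₀ * x)) Q := hβ₀
  have i1 : Integrable (fun x => Real.exp (β₀ * x) * (x - a)) Q := by
    have := (integrable_expMember_iff hβ₀).1 hmean
    simp_rw [mul_sub]
    exact this.sub (i0.mul_const a)
  have i2 : ∀ n : ℕ, Integrable (fun x => Real.exp ((β₀ - n) * x) * (x - a)) Q := fun n =>
    integrable_exp_mul_of_le hl (by linarith [n.cast_nonneg (α := ℝ)]) i1
  have nonneg : ∀ n : ℕ, 0 ≤ ∫ x, Real.exp ((β₀ - n) * x) * (x - a) ∂Q := by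
    intro n
    have hle : β₀ - n ≤ β₀ := by linarith [n.cast_nonneg (α := ℝ)]
    have hn := mem_canonicalSpace_of_le hl hle hβ₀
    have hi := integrable_expMember_of_le hl hle hβ₀ hmean
    have hge : a ≤ meanMap Q (β₀ - n) := ha.1 ⟨β₀ - n, hn, hi, rfl⟩
    have hZ := mgf_id_pos hQ hn
    rw [meanMap, integral_expMember, le_div_iff₀ hZ] at hge
    simp_rw [mul_sub]
    have hi' : Integrable (fun x => Real.exp ((β₀ - n) * x) * x) Q :=
      (integrable_expMember_iff hn).1 hi
    rw [integral_sub hi' ((mem_canonicalSpace_iff.1 hn).mul_const a), integral_mul_const]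
    linarith
  -- After multiplication by `exp(n c)` the integrand of `nonneg` is at most `G n`: the part on `[c,
  -- a)` is nonpositive and is dropped, and left of `c` the weight `exp(-n (x - c))` is at least
  -- `1`. The part on `[a, ∞)` vanishes in the limit, leaving a negative integral.
  set G : ℕ → ℝ → ℝ := fun n x => (Ici a).indicator
      (fun x => Real.exp (-(n : ℝ) * (x - c)) * (Real.exp (β₀ * x) * (x - a))) x
    - (Iio c).indicator (fun x => (a - c) * Real.exp (β₀ * x)) x with hG
  have jB : Integrable (fun x => (Iio c).indicator (fun x => (a - c) * Real.exp (β₀ * x)) x) Q :=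
    (i0.const_mul _).indicator measurableSet_Iio
  have hlim : Tendsto (fun n => ∫ x, G n x ∂Q) atTop
      (𝓝 (∫ x, -(Iio c).indicator (fun x => (a - c) * Real.exp (β₀ * x)) x ∂Q)) := by
    refine tendsto_integral_of_dominated_convergence
      (fun x => ‖Real.exp (β₀ * x) * (x - a)‖ + ‖(a - c) * Real.exp (β₀ * x)‖) ?_
      (i1.norm.add (i0.const_mul _).norm) ?_ ?_
    · intro n
      refine (Measurable.sub (Measurable.indicator ?_ measurableSet_Ici)
        (Measurable.indicator ?_ measurableSet_Iio)).aestronglyMeasurable <;> fun_prop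
    · intro n
      refine ae_of_all _ fun x => (norm_sub_le _ _).trans (add_le_add ?_ (norm_indicator_le_norm_self _ _))
      by_cases hx : x ∈ Ici a
      · have hxa : a ≤ x := hx
        rw [indicator_of_mem hx, norm_mul]
        refine mul_le_of_le_one_left (norm_nonneg _) ?_
        rw [Real.norm_eq_abs, Real.abs_exp, Real.exp_le_one_iff]
        nlinarith [n.cast_nonneg (α := ℝ)]
      · rw [indicator_of_notMem hx, norm_zero]; positivity
    · refine ae_of_all _ fun x => ?_
      rw [← zero_sub]
      refine Tendsto.sub ?_ tendsto_const_nhds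
      by_cases hx : x ∈ Ici a
      · have hxa : a ≤ x := hx
        simp only [indicator_of_mem hx]
        rw [← zero_mul (Real.exp (β₀ * x) * (x - a))]
        refine Tendsto.mul_const _ (Real.tendsto_exp_atBot.comp ?_)
        simp_rw [neg_mul]
        exact tendsto_neg_atTop_atBot.comp
          (tendsto_natCast_atTop_atTop.atTop_mul_const (by linarith))
      · simp only [indicator_of_notMem hx]; exact tendsto_const_nhds
  have hle : ∀ n : ℕ, 0 ≤ ∫ x, G n x ∂Q := by
    intro n
    have e : ∀ x, Real.exp ((n : ℝ) * c) * (Real.exp ((β₀ - n) * x) * (x - a))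
        = Real.exp (-(n : ℝ) * (x - c)) * (Real.exp (β₀ * x) * (x - a)) := by
      intro x
      rw [← mul_assoc, ← mul_assoc, ← Real.exp_add, ← Real.exp_add]
      congr 2; ring
    have h1 : 0 ≤ ∫ x, Real.exp ((n : ℝ) * c) * (Real.exp ((β₀ - n) * x) * (x - a)) ∂Q := by
      rw [integral_const_mul]; exact mul_nonneg (Real.exp_pos _).le (nonneg n)
    have j1 := (i2 n).const_mul (Real.exp ((n : ℝ) * c))
    simp_rw [e] at h1 j1
    refine h1.trans (integral_mono j1 ((j1.indicator measurableSet_Ici).sub jB) fun x => ?_)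
    simp only [hG]
    by_cases hx : x ∈ Ici a
    · have hxa : a ≤ x := hx
      rw [indicator_of_mem hx, indicator_of_notMem (by simp; linarith), sub_zero]
    · have hxa : x < a := not_le.1 hx
      rw [indicator_of_notMem hx, zero_sub]
      by_cases hxc : x ∈ Iio c
      · have hxc' : x < c := hxc
        rw [indicator_of_mem hxc]
        have h1 : 1 ≤ Real.exp (-(n : ℝ) * (x - c)) := by
          rw [Real.one_le_exp_iff]; nlinarith [n.cast_nonneg (α := ℝ)]
        have h2 := Real.exp_pos (β₀ * x)
        have h3 : Real.exp (β₀ * x) * (x - a) ≤ - ((a - c) * Real.exp (β₀ * x)) := by nlinarith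
        have h4 : Real.exp (β₀ * x) * (x - a) ≤ 0 :=
          mul_nonpos_of_nonneg_of_nonpos h2.le (by linarith)
        nlinarith
      · rw [indicator_of_notMem hxc, neg_zero]
        exact mul_nonpos_of_nonneg_of_nonpos (Real.exp_pos _).le
          (mul_nonpos_of_nonneg_of_nonpos (Real.exp_pos _).le (by linarith))
  have h0 := ge_of_tendsto' hlim hle
  rw [integral_neg, integral_indicator measurableSet_Iio, integral_const_mul] at h0
  have hpos : 0 < ∫ x in Iio c, Real.exp (β₀ * x) ∂Q := by
    have : Q.restrict (Iio c) ≠ 0 := by rwa [Ne, Measure.restrict_eq_zero]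
    have : NeZero (Q.restrict (Iio c)) := ⟨this⟩
    exact integral_exp_pos i0.integrableOn
  nlinarith [mul_pos (sub_pos.2 hc) hpos]

/-! ### Power behaviour of the density at `a` -/

theorem integrableOn_Ioo_sub_rpow_iff {a δ s : ℝ} (hδ : 0 < δ) :
    IntegrableOn (fun x : ℝ => (x - a) ^ s) (Ioo a (a + δ)) ↔ -1 < s := by
  rw [← intervalIntegral.integrableOn_Ioo_rpow_iff hδ,
    ← (measurePreserving_add_right volume a).integrableOn_comp_preimage
      (measurableEmbedding_addRight a)]
  have h1 : (fun x : ℝ => (x - a) ^ s) ∘ (fun x => x + a) = fun x => x ^ s := by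
    ext x; simp
  have h2 : (fun x => x + a) ⁻¹' Ioo a (a + δ) = Ioo 0 δ := by
    ext x; simp [add_comm a]
  rw [h1, h2]

/-- A density `(x - a) ^ (γ - 1) * g x` with `g` continuous and positive at `a` is comparable to
`(x - a) ^ (γ - 1)` on a right neighbourhood of `a`. -/
theorem exists_restrict_le_withDensity_rpow {Q : Measure ℝ} {a γ ε : ℝ} {g : ℝ → ℝ}
    (hg : ContinuousAt g a) (hga : 0 < g a) (hε : 0 < ε)
    (hdens : Q.restrict (Ioo a (a + ε)) = (volume.restrict (Ioo a (a + ε))).withDensity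
      (fun x => ENNReal.ofReal ((x - a) ^ (γ - 1) * g x))) {η : ℝ} (hη : 0 < η) :
    ∃ δ, 0 < δ ∧ δ ≤ η ∧
      (volume.restrict (Ioo a (a + δ))).withDensity
        (fun x => ENNReal.ofReal (g a / 2 * (x - a) ^ (γ - 1))) ≤ Q.restrict (Ioo a (a + δ)) ∧
      Q.restrict (Ioo a (a + δ)) ≤ (volume.restrict (Ioo a (a + δ))).withDensity
        (fun x => ENNReal.ofReal (2 * g a * (x - a) ^ (γ - 1))) := by
  have hev : ∀ᶠ x in 𝓝 a, g a / 2 < g x ∧ g x < 2 * g a :=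
    (hg.eventually_const_lt (by linarith)).and (hg.eventually_lt_const (by linarith))
  obtain ⟨δ₀, hδ₀, hball⟩ := Metric.eventually_nhds_iff.1 hev
  refine ⟨min δ₀ (min η ε), by positivity, by simp, ?_⟩
  set δ := min δ₀ (min η ε) with hδ
  have hsub : Ioo a (a + δ) ⊆ Ioo a (a + ε) :=
    Ioo_subset_Ioo_right (by linarith [min_le_right δ₀ (min η ε), min_le_right η ε])
  have hQ : Q.restrict (Ioo a (a + δ)) = (volume.restrict (Ioo a (a + δ))).withDensity
      (fun x => ENNReal.ofReal ((x - a) ^ (γ - 1) * g x)) := by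
    have := congrArg (fun μ : Measure ℝ => μ.restrict (Ioo a (a + δ))) hdens
    simp only [restrict_withDensity measurableSet_Ioo,
      Measure.restrict_restrict measurableSet_Ioo, inter_eq_left.2 hsub] at this
    exact this
  have hb : ∀ x ∈ Ioo a (a + δ), g a / 2 < g x ∧ g x < 2 * g a := by
    intro x hx
    refine hball ?_
    rw [Real.dist_eq, abs_lt]
    constructor <;> linarith [hx.1, hx.2, min_le_left δ₀ (min η ε)]
  rw [hQ]
  constructor <;>
  · refine withDensity_mono ((ae_restrict_iff' measurableSet_Ioo).2 (ae_of_all _ fun x hx => ?_))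
    refine ENNReal.ofReal_le_ofReal ?_
    have : 0 ≤ (x - a) ^ (γ - 1) := Real.rpow_nonneg (by linarith [hx.1]) _
    nlinarith [hb x hx]

section density

variable {Q : Measure ℝ} {a γ c δ : ℝ}

theorem measure_Ioo_pos_of_rpow_le (hc : 0 < c) (hδ : 0 < δ)
    (h : (volume.restrict (Ioo a (a + δ))).withDensity
      (fun x => ENNReal.ofReal (c * (x - a) ^ (γ - 1))) ≤ Q.restrict (Ioo a (a + δ))) :
    0 < Q (Ioo a (a + δ)) := by
  have h1 := h (Ioo a (a + δ))
  rw [Measure.restrict_apply_self, withDensity_apply _ measurableSet_Ioo,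
    Measure.restrict_restrict measurableSet_Ioo, inter_self] at h1
  refine lt_of_lt_of_le ?_ h1
  rw [setLIntegral_pos_iff (by fun_prop)]
  refine lt_of_lt_of_le (b := volume (Ioo a (a + δ))) (by simp [hδ]) (measure_mono fun x hx => ?_)
  refine ⟨?_, hx⟩
  rw [Function.mem_support, Ne, ENNReal.ofReal_eq_zero, not_le]
  exact mul_pos hc (Real.rpow_pos_of_pos (by linarith [hx.1]) _)

/-- Finite mass next to `a` makes `(x - a)^(γ - 1)` integrable there, which forces `γ - 1 > -1`.
This leaves room for a negative moment of order `p` in `(0, γ)`. -/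
theorem pos_of_rpow_le (hc : 0 < c) (hδ : 0 < δ) (hfin : Q (Ioo a (a + δ)) < ∞)
    (h : (volume.restrict (Ioo a (a + δ))).withDensity
      (fun x => ENNReal.ofReal (c * (x - a) ^ (γ - 1))) ≤ Q.restrict (Ioo a (a + δ))) :
    0 < γ := by
  have h1 := h (Ioo a (a + δ))
  rw [Measure.restrict_apply_self, withDensity_apply _ measurableSet_Ioo,
    Measure.restrict_restrict measurableSet_Ioo, inter_self] at h1
  have hi : IntegrableOn (fun x : ℝ => c * (x - a) ^ (γ - 1)) (Ioo a (a + δ)) := by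
    refine ⟨(by fun_prop : Measurable _).aestronglyMeasurable, ?_⟩
    rw [hasFiniteIntegral_iff_ofReal]
    · exact h1.trans_lt hfin
    · refine (ae_restrict_iff' measurableSet_Ioo).2 (ae_of_all _ fun x hx => ?_)
      exact mul_nonneg hc.le (Real.rpow_nonneg (by linarith [hx.1]) _)
  have := (integrable_const_mul_iff (IsUnit.mk0 c hc.ne') _).1 hi
  have := (integrableOn_Ioo_sub_rpow_iff hδ).1 this
  linarith

/-- A measure with density of order `(x - a) ^ (γ - 1)` at `a` has negative moments about `a`. -/
theorem integrableOn_exp_mul_sub_rpow (hc : 0 < c) (hδ : 0 < δ) {p : ℝ} (hp0 : 0 < p) (hp : p < γ) {β : ℝ}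
    (hβ : β ∈ canonicalSpace Q)
    (h : Q.restrict (Ioo a (a + δ)) ≤ (volume.restrict (Ioo a (a + δ))).withDensity
      (fun x => ENNReal.ofReal (c * (x - a) ^ (γ - 1)))) :
    IntegrableOn (fun x => Real.exp (β * x) * (x - a) ^ (-p)) (Ioi a) Q := by
  have hmeas : Measurable fun x : ℝ => (x - a) ^ (-p) := by fun_prop
  have hcont : Continuous fun x : ℝ => Real.exp (β * x) := by fun_prop
  -- Against Lebesgue measure the exponent becomes `γ - 1 - p > -1`. Beyond `a + δ` the power is at
  -- most `δ^(-p)`.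
  have h1 : IntegrableOn (fun x : ℝ => (x - a) ^ (-p)) (Ioo a (a + δ)) Q := by
    refine Integrable.mono_measure ?_ h
    rw [integrable_withDensity_iff (by fun_prop) (by simp)]
    have : IntegrableOn (fun x : ℝ => c * (x - a) ^ (γ - 1 - p)) (Ioo a (a + δ)) :=
      ((integrableOn_Ioo_sub_rpow_iff hδ).2 (by linarith)).const_mul _
    refine this.congr_fun (fun x hx => ?_) measurableSet_Ioo
    have hx' : 0 < x - a := sub_pos.2 hx.1
    simp only
    rw [ENNReal.toReal_ofReal (by positivity), sub_eq_add_neg (γ - 1), Real.rpow_add hx']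
    ring
  have h2 : IntegrableOn (fun x => Real.exp (β * x) * (x - a) ^ (-p)) (Ioo a (a + δ)) Q := by
    refine Integrable.bdd_mul (c := Real.exp (|β| * (|a| + δ))) h1 hcont.aestronglyMeasurable ?_
    refine (ae_restrict_iff' measurableSet_Ioo).2 (ae_of_all _ fun x hx => ?_)
    rw [Real.norm_eq_abs, Real.abs_exp, Real.exp_le_exp]
    refine (le_abs_self _).trans ?_
    rw [abs_mul]
    refine mul_le_mul_of_nonneg_left ?_ (abs_nonneg _)
    rw [abs_le]
    constructor <;> linarith [hx.1, hx.2, neg_abs_le a, le_abs_self a]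
  have h3 : IntegrableOn (fun x => Real.exp (β * x) * (x - a) ^ (-p)) (Ici (a + δ)) Q := by
    have h0 : IntegrableOn (fun x => Real.exp (β * x)) (Ici (a + δ)) Q :=
      Integrable.integrableOn (mem_canonicalSpace_iff.1 hβ)
    refine Integrable.mul_bdd (c := δ ^ (-p)) h0 hmeas.aestronglyMeasurable ?_
    refine (ae_restrict_iff' measurableSet_Ici).2 (ae_of_all _ fun x hx => ?_)
    have hx' : δ ≤ x - a := by have : a + δ ≤ x := hx; linarith
    rw [Real.norm_eq_abs, abs_of_nonneg (Real.rpow_nonneg (hδ.le.trans hx') _)]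
    exact Real.rpow_le_rpow_of_nonpos hδ hx' (by linarith)
  rw [← Ioo_union_Ici_eq_Ioi (show a < a + δ by linarith)]
  exact h2.union h3

end density

/-- Powers are dominated by the exponential. -/
theorem exists_rpow_le_mul_exp (r : ℝ) (hr : 0 ≤ r) :
    ∃ A, 0 < A ∧ ∀ u, 0 ≤ u → u ^ r ≤ A * Real.exp u := by
  obtain ⟨n, hn⟩ := exists_nat_ge r
  refine ⟨1 + n.factorial, by positivity, fun u hu => ?_⟩
  have h1 : u ^ r ≤ 1 + u ^ n := by
    rcases le_total u 1 with h | h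
    · linarith [Real.rpow_le_one hu h hr, pow_nonneg hu n]
    · have := Real.rpow_le_rpow_of_exponent_le h hn
      rw [Real.rpow_natCast] at this
      linarith
  have h2 := Real.pow_div_factorial_le_exp u hu n
  rw [div_le_iff₀ (by positivity)] at h2
  have h3 := Real.one_le_exp hu
  nlinarith

/-! ### Variance as the parameter tends to `-∞` -/

section tail

variable {Q : Measure ℝ} {a β₀ : ℝ}

theorem mem_interior_canonicalSpace_of_lt {β : ℝ} (ha : Q (Iio a) = 0)
    (h₀ : β₀ ∈ canonicalSpace Q) (h : β < β₀) : β ∈ interior (canonicalSpace Q) :=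
  mem_interior.2 ⟨Iio β₀, fun _ ht => mem_canonicalSpace_of_le ha (le_of_lt ht) h₀, isOpen_Iio, h⟩

/-- Decay of the variance when the left end point carries an atom and `Q` has a negative moment
about it. -/
theorem exists_sqrt_varMap_le_rpow (hQ : Q ≠ 0) (ha : Q (Iio a) = 0) (h₀ : β₀ ∈ canonicalSpace Q)
    (hatom : Q {a} ≠ 0) {p : ℝ} (hp : 0 < p)
    (hint : IntegrableOn (fun x => Real.exp (β₀ * x) * (x - a) ^ (-p)) (Ioi a) Q) :
    ∃ K, ∀ β < β₀, Real.sqrt (varMap Q β) ≤ K * (β₀ - β) ^ (-(1 + p / 2)) := by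
  have hfin := isFiniteMeasureOnCompacts_of_mem_canonicalSpace h₀
  have hq : 0 < Q.real {a} := ENNReal.toReal_pos hatom isCompact_singleton.measure_lt_top.ne
  obtain ⟨A, hA, hAle⟩ := exists_rpow_le_mul_exp (2 + p) (by positivity)
  set M := ∫ x in Ioi a, Real.exp (β₀ * x) * (x - a) ^ (-p) ∂Q with hM
  have hM0 : 0 ≤ M := setIntegral_nonneg measurableSet_Ioi fun x hx =>
    mul_nonneg (Real.exp_pos _).le (Real.rpow_nonneg (sub_nonneg.2 (le_of_lt hx)) _)
  refine ⟨Real.sqrt (A * M / (Real.exp (β₀ * a) * Q.real {a})), fun β hβ => ?_⟩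
  have hmem := mem_interior_canonicalSpace_of_lt ha h₀ hβ
  have hZ := mgf_id_pos hQ (interior_subset hmem)
  have hτ : 0 < β₀ - β := sub_pos.2 hβ
  -- The atom at `a` contributes nothing to the second moment about `a`. Elsewhere, with `τ = β₀ -
  -- β` and `u = τ (x - a)`, the bound `u^(2 + p) ≤ A exp u` gives `(x - a)^2 exp(-u) ≤ A τ^(-(2 +
  -- p)) (x - a)^(-p)`.
  have hN : ∫ x, Real.exp (β * x) * (x - a) ^ 2 ∂Q
      ≤ Real.exp (-((β₀ - β) * a)) * (A * (β₀ - β) ^ (-(2 + p))) * M := by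
    have e : ∫ x, Real.exp (β * x) * (x - a) ^ 2 ∂Q
        = ∫ x in Ioi a, Real.exp (β * x) * (x - a) ^ 2 ∂Q := by
      refine (setIntegral_eq_integral_of_ae_compl_eq_zero ?_).symm
      have hae : ∀ᵐ x ∂Q, a ≤ x := by
        rw [ae_iff]; simpa [Iio] using ha
      filter_upwards [hae] with x hx hx'
      have : x = a := le_antisymm (not_lt.1 hx') hx
      simp [this]
    rw [e, hM, ← integral_const_mul]
    refine integral_mono_of_nonneg (ae_of_all _ fun x => by positivity)
      (hint.const_mul _) ((ae_restrict_iff' measurableSet_Ioi).2 (ae_of_all _ fun x hx => ?_))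
    have hx : 0 < x - a := sub_pos.2 hx
    have h1 := hAle ((β₀ - β) * (x - a)) (by positivity)
    rw [Real.mul_rpow hτ.le hx.le] at h1
    have h2 : (x - a) ^ (2 + p) = (x - a) ^ 2 * (x - a) ^ p := by
      rw [Real.rpow_add hx]; norm_cast
    rw [h2] at h1
    have hτp := Real.rpow_pos_of_pos hτ (2 + p)
    have hxp := Real.rpow_pos_of_pos hx p
    have h3 : Real.exp (β * x)
        = Real.exp (-((β₀ - β) * a)) * Real.exp (β₀ * x)
          / Real.exp ((β₀ - β) * (x - a)) := by
      rw [← Real.exp_add, ← Real.exp_sub]; congr 1; ring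
    simp only
    rw [h3, Real.rpow_neg hτ.le, Real.rpow_neg hx.le]
    have h4 : (x - a) ^ 2 ≤ A * Real.exp ((β₀ - β) * (x - a))
        * ((β₀ - β) ^ (2 + p))⁻¹ * ((x - a) ^ p)⁻¹ := by
      rw [← div_eq_mul_inv, ← div_eq_mul_inv, le_div_iff₀ hxp, le_div_iff₀ hτp]
      linarith
    calc _ ≤ Real.exp (-((β₀ - β) * a)) * Real.exp (β₀ * x)
          / Real.exp ((β₀ - β) * (x - a)) * (A * Real.exp ((β₀ - β) * (x - a))
        * ((β₀ - β) ^ (2 + p))⁻¹ * ((x - a) ^ p)⁻¹) := by gcongr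
      _ = _ := by field_simp
  -- The atom alone bounds `Z(β)` below, with the same factor `exp(-(β₀ - β) a)` as in `hN`.
  have hZge : Real.exp (-((β₀ - β) * a)) * (Real.exp (β₀ * a) * Q.real {a})
      ≤ ∫ x, Real.exp (β * x) ∂Q := by
    have : ∫ x in {a}, Real.exp (β * x) ∂Q ≤ ∫ x, Real.exp (β * x) ∂Q :=
      setIntegral_le_integral (mem_canonicalSpace_iff.1 (interior_subset hmem)) (ae_of_all _ fun x => (Real.exp_pos _).le)
    rw [integral_singleton, smul_eq_mul] at this
    refine le_trans (le_of_eq ?_) this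
    rw [← mul_assoc, ← Real.exp_add, mul_comm]
    congr 2; ring
  have hv : varMap Q β ≤ A * M / (Real.exp (β₀ * a) * Q.real {a}) * (β₀ - β) ^ (-(2 + p)) := by
    refine (varMap_le hQ hmem a).trans ?_
    rw [div_le_iff₀ hZ]
    refine hN.trans ?_
    have h5 : 0 ≤ (β₀ - β) ^ (-(2 + p)) := Real.rpow_nonneg hτ.le _
    calc _ = A * M / (Real.exp (β₀ * a) * Q.real {a}) * (β₀ - β) ^ (-(2 + p))
          * (Real.exp (-((β₀ - β) * a)) * (Real.exp (β₀ * a) * Q.real {a})) := by field_simp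
      _ ≤ _ := by gcongr
  refine (Real.sqrt_le_sqrt hv).trans (le_of_eq ?_)
  rw [Real.sqrt_mul (by positivity)]
  congr 1
  rw [Real.sqrt_eq_rpow, ← Real.rpow_mul hτ.le]
  congr 1; ring

/-- Growth of the variance to the left is slower than exponential. -/
theorem exists_varMap_le_exp (hQ : Q ≠ 0) (ha : Q (Iio a) = 0) (h₀ : β₀ ∈ canonicalSpace Q)
    {δ : ℝ} (hpos : Q (Ioo a (a + δ)) ≠ 0) {b : ℝ} (hb : b < β₀) (hb0 : b ≤ 0) :
    ∃ q, 0 < q ∧ ∃ K, 0 ≤ K ∧ ∀ β < b, q * Real.exp (β * (a + δ)) ≤ ∫ x, Real.exp (β * x) ∂Q ∧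
      varMap Q β ≤ K * Real.exp (-(β * δ)) := by
  have hfin := isFiniteMeasureOnCompacts_of_mem_canonicalSpace h₀
  have hlt : Q (Ioo a (a + δ)) < ∞ :=
    (measure_mono Ioo_subset_Icc_self).trans_lt isCompact_Icc.measure_lt_top
  have hq : 0 < Q.real (Ioo a (a + δ)) := ENNReal.toReal_pos hpos hlt.ne
  have hae : ∀ᵐ x ∂Q, a ≤ x := by
    rw [ae_iff]; simpa [Iio] using ha
  have hbi := mem_interior_canonicalSpace_of_lt ha h₀ hb
  have hprob := isProbabilityMeasure_expMember hQ (interior_subset hbi)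
  -- The second moment is anchored at an interior parameter `b`, since it may be infinite at `β₀`.
  have hNint : Integrable (fun x => Real.exp (b * x) * (x - a) ^ 2) Q := by
    rw [← integrable_expMember_iff (interior_subset hbi) (f := fun x => (x - a) ^ 2)]
    exact ((memLp_two_expMember hbi).sub (memLp_const a)).integrable_sq
  set N := ∫ x, Real.exp (b * x) * (x - a) ^ 2 ∂Q with hN
  have hN0 : 0 ≤ N := integral_nonneg fun x => by positivity
  refine ⟨_, hq, N * Real.exp (-(b * a)) / Q.real (Ioo a (a + δ)), by positivity, fun β hβ => ?_⟩
  have hmem := mem_interior_canonicalSpace_of_lt ha h₀ (hβ.trans hb)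
  have hexp : Integrable (fun x => Real.exp (β * x)) Q :=
    mem_canonicalSpace_iff.1 (interior_subset hmem)
  have hZge : Q.real (Ioo a (a + δ)) * Real.exp (β * (a + δ)) ≤ ∫ x, Real.exp (β * x) ∂Q := by
    calc _ = ∫ x in Ioo a (a + δ), Real.exp (β * (a + δ)) ∂Q := by simp
      _ ≤ ∫ x in Ioo a (a + δ), Real.exp (β * x) ∂Q := by
        refine setIntegral_mono_on (integrableOn_const hlt.ne) hexp.integrableOn
          measurableSet_Ioo fun x hx => Real.exp_le_exp.2 ?_
        nlinarith [hx.2]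
      _ ≤ _ := setIntegral_le_integral hexp (ae_of_all _ fun x => (Real.exp_pos _).le)
  refine ⟨hZge, (varMap_le hQ hmem a).trans ?_⟩
  rw [div_le_iff₀ (mgf_id_pos hQ (interior_subset hmem))]
  have h1 : ∫ x, Real.exp (β * x) * (x - a) ^ 2 ∂Q ≤ Real.exp ((β - b) * a) * N := by
    rw [hN, ← integral_const_mul]
    refine integral_mono_of_nonneg (ae_of_all _ fun x => by positivity) (hNint.const_mul _) ?_
    filter_upwards [hae] with x hx
    rw [← mul_assoc, ← Real.exp_add]
    refine mul_le_mul_of_nonneg_right (Real.exp_le_exp.2 ?_) (sq_nonneg _)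
    nlinarith
  refine h1.trans ?_
  calc _ = N * Real.exp (-(b * a)) / Q.real (Ioo a (a + δ)) * Real.exp (-(β * δ))
        * (Q.real (Ioo a (a + δ)) * Real.exp (β * (a + δ))) := by
        have : Real.exp ((β - b) * a)
            = Real.exp (-(b * a)) * Real.exp (-(β * δ)) * Real.exp (β * (a + δ)) := by
          rw [← Real.exp_add, ← Real.exp_add]; congr 1; ring
        rw [this]; field_simp
    _ ≤ _ := by gcongr

end tail

/-! ### The Jeffreys integral in the canonical parameter -/

section jeffreys

variable {Q : Measure ℝ} {a β₀ : ℝ}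

theorem injOn_meanMap (hQ : ∀ c, ¬ ∀ᵐ x ∂Q, x = c) (ha : Q (Iio a) = 0)
    (h₀ : β₀ ∈ canonicalSpace Q) : InjOn (meanMap Q) (Iio β₀) := by
  have hmem : ∀ β ∈ Iio β₀, β ∈ interior (canonicalSpace Q) := fun β hβ =>
    mem_interior_canonicalSpace_of_lt ha h₀ hβ
  have hQ0 : Q ≠ 0 := by rintro rfl; exact hQ 0 (by simp)
  refine StrictMonoOn.injOn fun β hβ β' hβ' hlt => ?_
  have h := hmem β hβ
  have h' := hmem β' hβ'
  have := isProbabilityMeasure_expMember hQ0 (interior_subset h)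
  have := isProbabilityMeasure_expMember hQ0 (interior_subset h')
  exact meanMap_lt_meanMap hQ (interior_subset h) (interior_subset h')
    ((memLp_two_expMember h).integrable (by norm_num))
    ((memLp_two_expMember h').integrable (by norm_num)) hlt

/-- The conditional Jeffreys integral in terms of the canonical parameter. -/
theorem conditionalJeffreys_le_lintegral (hQ : ∀ c, ¬ ∀ᵐ x ∂Q, x = c) (ha : Q (Iio a) = 0)
    (h₀ : β₀ ∈ canonicalSpace Q) {m : ℕ} (x : Fin m → ℝ) :
    conditionalJeffreys Q (rightTruncation Q β₀) x ≤ ∫⁻ β in Iio β₀,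
      EReal.exp (-((m : EReal) * ((klDiv (meanMember Q (sampleAverage x))
        (expMember Q β) : ℝ≥0∞) : EReal))) * ENNReal.ofReal (Real.sqrt (varMap Q β)) := by
  have hQ0 : Q ≠ 0 := by rintro rfl; exact hQ 0 (by simp)
  have hmem : ∀ β ∈ Iio β₀, β ∈ interior (canonicalSpace Q) := fun β hβ =>
    mem_interior_canonicalSpace_of_lt ha h₀ hβ
  -- `β₀` need not be interior, so the mean may fail to be differentiable there; its value is a
  -- single null point.
  have hsub : meanRange Q (rightTruncation Q β₀) ⊆ meanMap Q '' Iio β₀ ∪ {meanMap Q β₀} := by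
    rintro y ⟨β, ⟨hβ, hle⟩, i, e⟩
    rcases (show β ≤ β₀ from hle).lt_or_eq with hlt | rfl
    · exact Or.inl ⟨β, hlt, e⟩
    · exact Or.inr e.symm
  rw [conditionalJeffreys]
  refine (lintegral_mono_set hsub).trans ((lintegral_union_le _ _ _).trans ?_)
  rw [Measure.restrict_singleton, Real.volume_singleton, zero_smul, lintegral_zero_measure,
    add_zero, lintegral_image_eq_lintegral_abs_deriv_mul measurableSet_Iio
      (fun β hβ => (hasDerivAt_meanMap (hmem β hβ)).hasDerivWithinAt) (injOn_meanMap hQ ha h₀)]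
  refine setLIntegral_mono' measurableSet_Iio fun β hβ => ?_
  have h := hmem β hβ
  have := isProbabilityMeasure_expMember hQ0 (interior_subset h)
  have hv : 0 ≤ varMap Q β := variance_nonneg _ _
  rw [varianceFunction_meanMap hQ h, meanMember_meanMap hQ (interior_subset h)
    ((memLp_two_expMember h).integrable (by norm_num)), abs_of_nonneg hv]
  rcases hv.eq_or_lt with h0 | hpos
  -- Zero variance is harmless because the Jacobian vanishes and `0 * ∞ = 0`.
  · simp [← h0]
  · rw [← mul_div_assoc, mul_comm, mul_div_assoc, ENNReal.ofReal_rpow_of_pos hpos,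
      ← Real.sqrt_eq_rpow, ← ENNReal.ofReal_div_of_pos (Real.sqrt_pos.2 hpos), Real.div_sqrt]

/-- The part of the Jeffreys integral near the right end point. -/
theorem lintegral_Ico_sqrt_varMap_lt_top (hQ : ∀ c, ¬ ∀ᵐ x ∂Q, x = c) (ha : Q (Iio a) = 0)
    (h₀ : β₀ ∈ canonicalSpace Q) (hmean : Integrable id (expMember Q β₀)) (b : ℝ) :
    ∫⁻ β in Ico b β₀, ENNReal.ofReal (Real.sqrt (varMap Q β)) < ∞ := by
  have hle : ∀ β, ENNReal.ofReal (Real.sqrt (varMap Q β))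
      ≤ 1 + ENNReal.ofReal |varMap Q β| := by
    intro β
    have hv : 0 ≤ varMap Q β := variance_nonneg _ _
    rw [← ENNReal.ofReal_one, ← ENNReal.ofReal_add zero_le_one (abs_nonneg _), abs_of_nonneg hv]
    refine ENNReal.ofReal_le_ofReal (Real.sqrt_le_iff.2 ⟨by linarith, by nlinarith⟩)
  refine (lintegral_mono hle).trans_lt ?_
  rw [lintegral_add_left measurable_const]
  refine ENNReal.add_lt_top.2 ⟨by simp, ?_⟩
  have hsub : Ico b β₀ ⊆ Iio β₀ := fun _ h => h.2
  -- The integral of the variance is the length of the set of means, which monotonicity confines to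
  -- a bounded interval.
  have := lintegral_image_eq_lintegral_abs_deriv_mul (measurableSet_Ico (a := b) (b := β₀))
    (fun β hβ => (hasDerivAt_meanMap
      (mem_interior_canonicalSpace_of_lt ha h₀ (hsub hβ))).hasDerivWithinAt)
    ((injOn_meanMap hQ ha h₀).mono hsub) (fun _ => 1)
  simp only [mul_one, setLIntegral_one] at this
  rw [← this]
  refine (measure_mono (t := Icc (meanMap Q b) (meanMap Q β₀)) ?_).trans_lt
    isCompact_Icc.measure_lt_top
  have hmono : ∀ β β', β ≤ β' → β' ≤ β₀ → meanMap Q β ≤ meanMap Q β' := by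
    intro β β' h h'
    rcases h.eq_or_lt with rfl | hlt
    · exact le_rfl
    · exact (meanMap_lt_meanMap hQ (mem_canonicalSpace_of_le ha (h.trans h') h₀)
        (mem_canonicalSpace_of_le ha h' h₀) (integrable_expMember_of_le ha (h.trans h') h₀ hmean)
        (integrable_expMember_of_le ha h' h₀ hmean) hlt).le
  rintro _ ⟨β, hβ, rfl⟩
  exact ⟨hmono _ _ hβ.1 hβ.2.le, hmono _ _ hβ.2.le le_rfl⟩

theorem lintegral_Iio_rpow_lt_top (K β₀ : ℝ) {s : ℝ} (hs : s < -1) :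
    ∫⁻ β in Iio (β₀ - 1), ENNReal.ofReal (K * (β₀ - β) ^ s) < ∞ := by
  have h1 := integrableOn_Ioi_rpow_of_lt hs one_pos
  rw [← (Measure.measurePreserving_sub_left volume β₀).integrableOn_comp_preimage
    (Homeomorph.subLeft β₀).measurableEmbedding] at h1
  have h2 : (fun x => β₀ - x) ⁻¹' Ioi 1 = Iio (β₀ - 1) := by
    ext x; simp only [mem_preimage, mem_Ioi, mem_Iio]; constructor <;> intro h <;> linarith
  rw [h2] at h1
  exact (h1.const_mul K).lintegral_lt_top

/-- The part of the Jeffreys integral near `-∞` when the sample average exceeds `a`. -/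
theorem exists_lintegral_Iio_lt_top (hQ : Q ≠ 0) (ha : Q (Iio a) = 0)
    (h₀ : β₀ ∈ canonicalSpace Q) (hpos : ∀ δ > 0, Q (Ioo a (a + δ)) ≠ 0) {x C : ℝ} (hax : a < x)
    (hC : 0 < C) {E : ℝ → ℝ≥0∞} (hE : ∀ β ∈ canonicalSpace Q,
      E β ≤ ENNReal.ofReal (C * Real.exp (β * x) / ∫ x, Real.exp (β * x) ∂Q)) :
    ∃ b < β₀, ∫⁻ β in Iio b, E β * ENNReal.ofReal (Real.sqrt (varMap Q β)) < ∞ := by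
  -- The likelihood is of order at most `exp(β (x - a - δ))` and `√V ≤ 1 + V` costs `exp(-β δ)`; a
  -- third of the gap leaves `exp(β δ)`, integrable at `-∞`.
  set δ := (x - a) / 3 with hδ
  have hδ0 : 0 < δ := by linarith
  have hb : min β₀ 0 - 1 < β₀ := by linarith [min_le_left β₀ 0]
  refine ⟨min β₀ 0 - 1, hb, ?_⟩
  obtain ⟨q, hq, K, hK, H⟩ := exists_varMap_le_exp hQ ha h₀ (hpos δ hδ0) hb
    (by linarith [min_le_right β₀ 0])
  have hint : IntegrableOn (fun β => C / q * (1 + K) * Real.exp (δ * β)) (Iic (min β₀ 0 - 1)) :=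
    (integrableOn_exp_mul_Iic hδ0 _).const_mul _
  refine lt_of_le_of_lt ?_ (hint.mono_set Iio_subset_Iic_self).lintegral_lt_top
  refine setLIntegral_mono' measurableSet_Iio fun β hβ => ?_
  obtain ⟨hZ, hv⟩ := H β hβ
  have hβ' : β < min β₀ 0 - 1 := hβ
  have hβ0 : β ≤ 0 := by linarith [min_le_right β₀ 0]
  refine (mul_le_mul_left (hE β
    (mem_canonicalSpace_of_le ha (by linarith) h₀)) _).trans ?_
  have hZ0 : 0 < ∫ x, Real.exp (β * x) ∂Q := lt_of_lt_of_le (by positivity) hZ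
  rw [← ENNReal.ofReal_mul (by positivity)]
  refine ENNReal.ofReal_le_ofReal ?_
  have hv0 : 0 ≤ varMap Q β := variance_nonneg _ _
  have h1 : Real.sqrt (varMap Q β) ≤ (1 + K) * Real.exp (-(β * δ)) := by
    have h2 : Real.sqrt (varMap Q β) ≤ 1 + varMap Q β :=
      Real.sqrt_le_iff.2 ⟨by linarith, by nlinarith⟩
    have h3 : 1 ≤ Real.exp (-(β * δ)) := Real.one_le_exp (by nlinarith)
    linarith
  calc C * Real.exp (β * x) / (∫ x, Real.exp (β * x) ∂Q) * Real.sqrt (varMap Q β)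
      ≤ C * Real.exp (β * x) / (q * Real.exp (β * (a + δ)))
        * ((1 + K) * Real.exp (-(β * δ))) := by gcongr
    _ = C / q * (1 + K) * Real.exp (δ * β) := by
      have : Real.exp (β * x)
          = Real.exp (δ * β) * Real.exp (β * (a + δ)) * Real.exp (β * δ) := by
        rw [← Real.exp_add, ← Real.exp_add]; congr 1; rw [hδ]; ring
      rw [this, Real.exp_neg]
      field_simp

end jeffreys

/-! ### Assembly -/

theorem mainTheorem10
    (Q : Measure ℝ) (hcore : BddBelow (convexCore Q))
    (a : ℝ) (ha : IsGLB (meanRange Q (canonicalSpace Q)) a)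
    (γ : ℝ) (g : ℝ → ℝ) (hg : AnalyticAt ℝ g a) (hga : 0 < g a)
    (ε : ℝ) (hε : 0 < ε)
    (hdens : Q.restrict (Set.Ioo a (a + ε)) =
      (volume.restrict (Set.Ioo a (a + ε))).withDensity
        (fun x => ENNReal.ofReal ((x - a) ^ (γ - 1) * g x)))
    (β₀ : ℝ) (hβ₀ : β₀ ∈ canonicalSpace Q) (hmean : Integrable id (expMember Q β₀))
    (m : ℕ) (hm : 1 ≤ m) (x : Fin m → ℝ) (hx : sampleAverage x ∈ extendedMeanRange Q) :
    conditionalJeffreys Q (rightTruncation Q β₀) x < ∞ := by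
  have hfin := isFiniteMeasureOnCompacts_of_mem_canonicalSpace hβ₀
  have hbounds := fun η (hη : 0 < η) =>
    exists_restrict_le_withDensity_rpow hg.continuousAt hga hε hdens hη
  have hpos : ∀ δ > 0, Q (Ioo a (a + δ)) ≠ 0 := by
    intro η hη
    obtain ⟨δ, hδ, hle, hlow, -⟩ := hbounds η hη
    exact ((measure_Ioo_pos_of_rpow_le (half_pos hga) hδ hlow).trans_le
      (measure_mono (Ioo_subset_Ioo_right (by linarith)))).ne'
  have hQ : ∀ c, ¬ ∀ᵐ x ∂Q, x = c := by
    intro c hc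
    rw [ae_iff] at hc
    rcases le_or_gt c a with h | h
    · exact hpos 1 one_pos (measure_mono_null (fun y hy => ne_of_gt (h.trans_lt hy.1)) hc)
    · refine hpos (c - a) (by linarith) (measure_mono_null (fun y hy => ne_of_lt ?_) hc)
      linarith [hy.2]
  have hQ0 : Q ≠ 0 := by rintro rfl; exact hQ 0 (by simp)
  obtain ⟨l, hl⟩ := exists_measure_Iio_eq_zero hcore (a := a) fun h =>
    hpos 1 one_pos (measure_mono_null Ioo_subset_Ioi_self h)
  have haQ := measure_Iio_eq_zero_of_isGLB hQ0 hl hβ₀ hmean ha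
  obtain ⟨C, hC, hE⟩ := exists_exp_klDiv_le hQ0 hx hm
  refine (conditionalJeffreys_le_lintegral hQ haQ hβ₀ x).trans_lt ?_
  suffices H : ∃ b < β₀, ∫⁻ β in Iio b,
      EReal.exp (-((m : EReal) * ((klDiv (meanMember Q (sampleAverage x))
        (expMember Q β) : ℝ≥0∞) : EReal))) * ENNReal.ofReal (Real.sqrt (varMap Q β)) < ∞ by
    obtain ⟨b, hb, hlt⟩ := H
    rw [← Iio_union_Ico_eq_Iio hb.le]
    refine (lintegral_union_le _ _ _).trans_lt (ENNReal.add_lt_top.2 ⟨hlt, ?_⟩)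
    refine lt_of_le_of_lt (lintegral_mono fun β => ?_)
      (lintegral_Ico_sqrt_varMap_lt_top hQ haQ hβ₀ hmean b)
    exact mul_le_of_le_one_left' (ereal_exp_neg_mul_klDiv_le_one _ _ _)
  -- Lowering the parameter by one strictly lowers the mean, so the infimum is not attained.
  have hrange : ∀ y ∈ meanRange Q (canonicalSpace Q), a < y := by
    rintro y ⟨β, hβ, i, rfl⟩
    have h' := mem_canonicalSpace_of_le haQ (sub_one_lt β).le hβ
    have i' := integrable_expMember_of_le haQ (sub_one_lt β).le hβ i
    exact (ha.1 ⟨β - 1, h', i', rfl⟩).trans_lt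
      (meanMap_lt_meanMap hQ h' hβ i' i (sub_one_lt β))
  have hcases : a < sampleAverage x ∨ Q {a} ≠ 0 := by
    rcases hx with (h | h) | h
    · exact Or.inl (hrange _ h)
    · exact Or.inr (h.1.unique ha ▸ h.2.1)
    · have hy : meanMap Q β₀ ∈ meanRange Q (canonicalSpace Q) := ⟨β₀, hβ₀, hmean, rfl⟩
      exact Or.inl ((hrange _ hy).trans_le (h.1.1 hy))
  rcases hcases with hax | hatom
  · exact exists_lintegral_Iio_lt_top hQ0 haQ hβ₀ hpos hax hC hE
  · obtain ⟨δ, hδ, -, hlow, hup⟩ := hbounds 1 one_pos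
    have hγ := pos_of_rpow_le (half_pos hga) hδ
      ((measure_mono Ioo_subset_Icc_self).trans_lt isCompact_Icc.measure_lt_top) hlow
    obtain ⟨K, hK⟩ := exists_sqrt_varMap_le_rpow hQ0 haQ hβ₀ hatom (half_pos hγ)
      (integrableOn_exp_mul_sub_rpow (by linarith) hδ (half_pos hγ) (half_lt_self hγ) hβ₀ hup)
    -- The choice `p = γ / 2` gives the exponent `-(1 + γ / 4) < -1`; the divergence factor is only
    -- bounded by `1`.
    refine ⟨β₀ - 1, sub_one_lt β₀, lt_of_le_of_lt ?_ (lintegral_Iio_rpow_lt_top K β₀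
      (s := -(1 + γ / 2 / 2)) (by linarith))⟩
    refine setLIntegral_mono' measurableSet_Iio fun β hβ => ?_
    refine (mul_le_of_le_one_left' (ereal_exp_neg_mul_klDiv_le_one _ _ _)).trans
      (ENNReal.ofReal_le_ofReal (hK β ?_))
    have : β < β₀ - 1 := hβ
    linarith
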